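/- Let $G$ be a profinite group. A \emph{spectrum} is a Bousfield--Friedlander spectrum of simplicial sets, i.e. a sequence of pointed simplicial sets $X_k$ ($k\ge 0$) with pointed structure maps $S^1\wedge X_k\to X_{k+1}$, where $S^1=\Delta^1/\partial\Delta^1$. A \emph{$G$-spectrum} is a spectrum with an action of $G$ by maps of spectra; it is \emph{discrete} if for all $k,l\ge 0$ the action map $G\times (X_k)_l\to (X_k)_l$ is continuous when $(X_k)_l$ has the discrete topology. For a small category $\mathcal C$ and a functor $Z$ from $\mathcal C$ to spectra, $\mathrm{holim}_{\mathcal C}Z$ is the equalizer of the two canonical maps $$\prod_{c\in\mathcal C} Z(c)^{B(\mathcal C\downarrow c)}\rightrightarrows\prod_{\sigma\colon c\to d} Z(d)^{B(\mathcal C\downarrow c)},$$ where $B$ is the nerve and $Z^K$ is the levelwise simplicial mapping spectrum; if $Z$ is a diagram of $G$-spectra, $G$ acts on $\mathrm{holim}_{\mathcal C}Z$ through its action on the $Z(c)$. The site $G\text{-}\mathbf{Sets}_{df}$ is the category of finite discrete $G$-sets (finite sets with continuous $G$-action) with the topology whose covering families are the jointly surjective ones. For a $G$-spectrum $Y$,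 $\mathrm{Hom}_G(-,Y)$ is the presheaf of spectra on this site with $(\mathrm{Hom}_G(S,Y)_k)_l=\mathrm{Hom}_G(S,(Y_k)_l)$. Let $\mathcal C$ be a small category and let $X$ be a $\mathcal C$-diagram of discrete $G$-spectra and equivariant maps. Let $\mathrm{holim}_{\mathcal C}\mathrm{Hom}_G(-,X)$ be the presheaf of spectra $S\mapsto \mathrm{holim}_{\mathcal C}\mathrm{Hom}_G(S,X)$, and let $$\mathcal F=\mathrm{Hom}_G\bigl(-,\ \mathrm{colim}_{N}(\mathrm{holim}_{\mathcal C}X)^N\bigr),$$ where $N$ runs over the open normal subgroups of $G$ and the homotopy limit of $X$ is formed in spectra. Then $\mathcal F$ is a sheaf of spectra on $G\text{-}\mathbf{Sets}_{df}$, and the presheaves of spectra $\mathrm{holim}_{\mathcal C}\mathrm{Hom}_G(-,X)$ and $\mathcal F$ are isomorphic. In particular, $\mathrm{holim}_{\mathcal C}\mathrm{Hom}_G(-,X)$ is a sheaf of spectra. -/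

import Mathlib

open CategoryTheory Opposite MonoidalCategory CartesianMonoidalCategory
open scoped Simplicial FintypeCatDiscrete

universe u

noncomputable section

lemma types_ext {A B : Type u} {f g : A ⟶ B} (h : ∀ a, f a = g a) : f = g :=
  ConcreteCategory.hom_ext _ _ h

lemma sset_map_id {X : SSet.{u}} {n} (x : X.obj n) : X.map (𝟙 n) x = x := by
  simp

lemma sset_map_comp {X : SSet.{u}} {l m n} (θ : l ⟶ m) (θ' : m ⟶ n) (x : X.obj l) :
    X.map (θ ≫ θ') x = X.map θ' (X.map θ x) := by
  simp

/-! ### Pointed simplicial sets, the circle and the smash product -/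

/-- A pointed simplicial set: a simplicial set with a compatible choice of base points
(that is, a map from the terminal simplicial set). -/
structure PointedSSet : Type (u + 1) where
  sset : SSet.{u}
  pt : ∀ n : SimplexCategoryᵒᵖ, sset.obj n
  map_pt : ∀ {m n : SimplexCategoryᵒᵖ} (θ : m ⟶ n), sset.map θ (pt m) = pt n

namespace PointedSSet

/-- Base point preserving simplicial maps. -/
@[ext]
structure Hom (X Y : PointedSSet.{u}) : Type u where
  hom : X.sset ⟶ Y.sset
  hom_pt : ∀ n, hom.app n (X.pt n) = Y.pt n

instance : Category PointedSSet.{u} where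
  Hom X Y := Hom X Y
  id X := ⟨𝟙 X.sset, fun _ => rfl⟩
  comp f g := ⟨f.hom ≫ g.hom, fun n => by
    rw [NatTrans.comp_app, types_comp_apply, f.hom_pt, g.hom_pt]⟩

@[ext]
lemma hom_ext {X Y : PointedSSet.{u}} {f g : X ⟶ Y}
    (h : ∀ n x, f.hom.app n x = g.hom.app n x) : f = g := by
  apply Hom.ext
  ext n x
  exact h n x

@[simp] lemma id_app {X : PointedSSet.{u}} (n) (x : X.sset.obj n) :
    (Hom.hom (𝟙 X)).app n x = x := rfl

@[simp] lemma comp_app {X Y Z : PointedSSet.{u}} (f : X ⟶ Y) (g : Y ⟶ Z) (n) (x : X.sset.obj n) :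
    (f ≫ g).hom.app n x = g.hom.app n (f.hom.app n x) := rfl

/-- The quotient `X / A` of a simplicial set by a subcomplex `A`, pointed by the class of `A`
(a point `a` of `A` is supplied in each degree). -/
def collapse (X : SSet.{u}) (A : X.Subcomplex) (a : ∀ n, X.obj n) (ha : ∀ n, a n ∈ A.obj n) :
    PointedSSet.{u} where
  sset :=
    { obj n := Quot (fun x y : X.obj n => x ∈ A.obj n ∧ y ∈ A.obj n)
      map θ := ↾(Quot.map (X.map θ) (fun _ _ h => ⟨A.map θ h.1, A.map θ h.2⟩))
      map_id _ := by
        ext ⟨x⟩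
        exact congrArg (Quot.mk _) (by simp)
      map_comp θ θ' := by
        ext ⟨x⟩
        exact congrArg (Quot.mk _) (by simp) }
  pt n := Quot.mk _ (a n)
  map_pt θ := Quot.sound ⟨A.map θ (ha _), ha _⟩

/-- The quotient map `X ⟶ X / A`. -/
def collapseMk (X : SSet.{u}) (A : X.Subcomplex) (a : ∀ n, X.obj n) (ha : ∀ n, a n ∈ A.obj n) :
    X ⟶ (collapse X A a ha).sset where
  app _ := ↾(fun x => Quot.mk _ x)
  naturality _ _ _ := rfl

/-- A map out of `X` that is trivial on `A` factors through `X / A`. -/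
def collapseDesc {X : SSet.{u}} {A : X.Subcomplex} {a : ∀ n, X.obj n}
    {ha : ∀ n, a n ∈ A.obj n} {Y : PointedSSet.{u}} (f : X ⟶ Y.sset)
    (hf : ∀ n, ∀ x ∈ A.obj n, f.app n x = Y.pt n) : collapse X A a ha ⟶ Y where
  hom :=
    { app n := ↾(Quot.lift (f.app n) (fun x y h => (hf n x h.1).trans (hf n y h.2).symm))
      naturality _ _ θ := by
        ext ⟨x⟩
        exact NatTrans.naturality_apply f θ x }
  hom_pt n := hf n _ (ha n)

/-- The simplicial circle `S¹ = Δ[1] / ∂Δ[1]`. -/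
def circle : PointedSSet.{u} :=
  collapse Δ[1] (SSet.boundary 1) (fun n => SSet.stdSimplex.const 1 0 n) (fun n h => by
    obtain ⟨i, hi⟩ := h 1
    change (0 : Fin 2) = 1 at hi
    exact absurd hi (by decide))

/-- The wedge `A ∨ X` inside `A × X`. -/
def wedge (A X : PointedSSet.{u}) : (A.sset ⊗ X.sset).Subcomplex where
  obj n := {p | p.1 = A.pt n ∨ p.2 = X.pt n}
  map {m n} θ p hp := by
    rcases hp with hp | hp
    · exact Or.inl ((congrArg (A.sset.map θ) hp).trans (A.map_pt θ))
    · exact Or.inr ((congrArg (X.sset.map θ) hp).trans (X.map_pt θ))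

/-- The smash product `A ∧ X = (A × X) / (A ∨ X)`. -/
def smash (A X : PointedSSet.{u}) : PointedSSet.{u} :=
  collapse (A.sset ⊗ X.sset) (wedge A X) (fun n => (A.pt n, X.pt n)) (fun _ => Or.inl rfl)

/-- The class `a ∧ x` of a pair of simplices. -/
def smashMk {A X : PointedSSet.{u}} {n : SimplexCategoryᵒᵖ} (a : A.sset.obj n) (x : X.sset.obj n) :
    (smash A X).sset.obj n :=
  Quot.mk _ (a, x)


/-- A map out of `A × X` that is trivial on `A ∨ X` induces a map out of `A ∧ X`. -/
def smashDesc {A X Y : PointedSSet.{u}} (f : A.sset ⊗ X.sset ⟶ Y.sset)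
    (h₁ : ∀ n x, f.app n (A.pt n, x) = Y.pt n) (h₂ : ∀ n a, f.app n (a, X.pt n) = Y.pt n) :
    smash A X ⟶ Y :=
  collapseDesc f (fun n p hp => by
    obtain ⟨a, x⟩ := p
    rcases hp with hp | hp
    · obtain rfl : a = A.pt n := hp
      exact h₁ n x
    · obtain rfl : x = X.pt n := hp
      exact h₂ n a)

/-- Functoriality of the smash product in the second variable: `a ∧ x ↦ a ∧ f x`. -/
def smashMap (A : PointedSSet.{u}) {X Y : PointedSSet.{u}} (f : X ⟶ Y) : smash A X ⟶ smash A Y :=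
  collapseDesc ((A.sset ◁ f.hom) ≫ collapseMk _ _ _ _) (fun n p hp => by
    refine Quot.sound ⟨?_, Or.inl rfl⟩
    rcases hp with hp | hp
    · exact Or.inl hp
    · exact Or.inr ((congrArg (f.hom.app n) hp).trans (f.hom_pt n)))

lemma smash_ind {A X : PointedSSet.{u}} {n : SimplexCategoryᵒᵖ}
    {motive : (smash A X).sset.obj n → Prop} (h : ∀ a x, motive (smashMk a x)) (z) : motive z :=
  Quot.ind (fun p => h p.1 p.2) z

lemma smash_hom_ext {A X Y : PointedSSet.{u}} {f g : smash A X ⟶ Y}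
    (h : ∀ n a x, f.hom.app n (smashMk a x) = g.hom.app n (smashMk a x)) : f = g := by
  ext n z
  exact smash_ind (motive := fun z => f.hom.app n z = g.hom.app n z) (h n) z

@[simp] lemma smashDesc_mk {A X Y : PointedSSet.{u}} (f : A.sset ⊗ X.sset ⟶ Y.sset)
    (h₁ : ∀ n x, f.app n (A.pt n, x) = Y.pt n) (h₂ : ∀ n a, f.app n (a, X.pt n) = Y.pt n)
    {n} (a : A.sset.obj n) (x : X.sset.obj n) :
    (smashDesc f h₁ h₂).hom.app n (smashMk a x) = f.app n (a, x) := rfl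

@[simp] lemma smashMap_mk (A : PointedSSet.{u}) {X Y : PointedSSet.{u}} (f : X ⟶ Y)
    {n} (a : A.sset.obj n) (x : X.sset.obj n) :
    (smashMap A f).hom.app n (smashMk a x) = smashMk a (f.hom.app n x) := rfl

lemma smash_map_mk {A X : PointedSSet.{u}} {m n : SimplexCategoryᵒᵖ} (θ : m ⟶ n)
    (a : A.sset.obj m) (x : X.sset.obj m) :
    (smash A X).sset.map θ (smashMk a x) = smashMk (A.sset.map θ a) (X.sset.map θ x) := rfl

lemma smashMk_pt_left {A X : PointedSSet.{u}} {n} (x : X.sset.obj n) :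
    smashMk (A.pt n) x = (smash A X).pt n := Quot.sound ⟨Or.inl rfl, Or.inl rfl⟩

lemma smashMk_pt_right {A X : PointedSSet.{u}} {n} (a : A.sset.obj n) :
    smashMk a (X.pt n) = (smash A X).pt n := Quot.sound ⟨Or.inr rfl, Or.inl rfl⟩

end PointedSSet

open PointedSSet

/-! ### Spectra -/

/-- A (Bousfield–Friedlander) spectrum of simplicial sets: pointed simplicial sets `X₀, X₁, …`
with pointed structure maps `S¹ ∧ Xₖ ⟶ Xₖ₊₁`. -/
structure Spectrum : Type (u + 1) where
  level : ℕ → PointedSSet.{u}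
  str : ∀ k, smash circle (level k) ⟶ level (k + 1)

namespace Spectrum

/-- Maps of spectra: levelwise pointed maps that commute with the structure maps. -/
@[ext]
structure Hom (X Y : Spectrum.{u}) : Type u where
  level : ∀ k, X.level k ⟶ Y.level k
  comm : ∀ k, X.str k ≫ level (k + 1) = smashMap circle (level k) ≫ Y.str k

instance : Category Spectrum.{u} where
  Hom X Y := Hom X Y
  id X := ⟨fun k => 𝟙 (X.level k), fun k => smash_hom_ext fun _ _ _ => rfl⟩
  comp {X Y Z} f g := ⟨fun k => f.level k ≫ g.level k, fun k => by
    rw [← Category.assoc, f.comm, Category.assoc, g.comm]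
    exact smash_hom_ext fun _ _ _ => rfl⟩

/-- The set `(Xₖ)ₙ` of `n`-simplices of the `k`-th simplicial set of a spectrum. -/
abbrev Simplex (X : Spectrum.{u}) (k : ℕ) (n : SimplexCategoryᵒᵖ) : Type u :=
  (X.level k).sset.obj n

/-- The value of a map of spectra on a simplex. -/
def ap {X Y : Spectrum.{u}} (f : X ⟶ Y) {k : ℕ} {n : SimplexCategoryᵒᵖ} (x : X.Simplex k n) :
    Y.Simplex k n :=
  (Hom.level f k).hom.app n x

/-- The value of the structure map `S¹ ∧ Xₖ ⟶ Xₖ₊₁` on `t ∧ x`. -/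
def sus (X : Spectrum.{u}) {k : ℕ} {n : SimplexCategoryᵒᵖ} (t : (circle.{u}).sset.obj n)
    (x : X.Simplex k n) : X.Simplex (k + 1) n :=
  (X.str k).hom.app n (smashMk t x)

@[ext]
lemma hom_ext {X Y : Spectrum.{u}} {f g : X ⟶ Y}
    (h : ∀ k n (x : X.Simplex k n), ap f x = ap g x) : f = g := by
  apply Hom.ext
  funext k
  ext n x
  exact h k n x

@[simp] lemma ap_id {X : Spectrum.{u}} {k n} (x : X.Simplex k n) : ap (𝟙 X) x = x := rfl

@[simp] lemma ap_comp {X Y Z : Spectrum.{u}} (f : X ⟶ Y) (g : Y ⟶ Z) {k n} (x : X.Simplex k n) :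
    ap (f ≫ g) x = ap g (ap f x) := rfl

lemma ap_pt {X Y : Spectrum.{u}} (f : X ⟶ Y) (k n) :
    ap f ((X.level k).pt n) = (Y.level k).pt n := (Hom.level f k).hom_pt n

lemma ap_map {X Y : Spectrum.{u}} (f : X ⟶ Y) {k m n} (θ : m ⟶ n) (x : X.Simplex k m) :
    ap f ((X.level k).sset.map θ x) = (Y.level k).sset.map θ (ap f x) :=
  NatTrans.naturality_apply (Hom.level f k).hom θ x

lemma ap_sus {X Y : Spectrum.{u}} (f : X ⟶ Y) {k n} (t : (circle.{u}).sset.obj n)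
    (x : X.Simplex k n) : ap f (X.sus t x) = Y.sus t (ap f x) :=
  congrArg (fun φ : smash circle (X.level k) ⟶ Y.level (k + 1) => φ.hom.app n (smashMk t x))
    (Hom.comm f k)

lemma map_sus (X : Spectrum.{u}) {k m n} (θ : m ⟶ n) (t : (circle.{u}).sset.obj m)
    (x : X.Simplex k m) : (X.level (k + 1)).sset.map θ (X.sus t x) =
      X.sus ((circle.{u}).sset.map θ t) ((X.level k).sset.map θ x) :=
  (NatTrans.naturality_apply (X.str k).hom θ (smashMk t x)).symm

lemma sus_pt_left (X : Spectrum.{u}) {k n} (x : X.Simplex k n) :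
    X.sus ((circle.{u}).pt n) x = (X.level (k + 1)).pt n :=
  (congrArg _ (smashMk_pt_left x)).trans ((X.str k).hom_pt n)

lemma sus_pt_right (X : Spectrum.{u}) {k n} (t : (circle.{u}).sset.obj n) :
    X.sus t ((X.level k).pt n) = (X.level (k + 1)).pt n :=
  (congrArg _ (smashMk_pt_right t)).trans ((X.str k).hom_pt n)

/-- Constructor for a structure map `S¹ ∧ X ⟶ Y` from its values on the classes `t ∧ x`. -/
def strMk {X Y : PointedSSet.{u}}
    (s : ∀ n, (circle.{u}).sset.obj n → X.sset.obj n → Y.sset.obj n)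
    (s_map : ∀ {m n} (θ : m ⟶ n) t x,
      Y.sset.map θ (s m t x) = s n ((circle.{u}).sset.map θ t) (X.sset.map θ x))
    (s_left : ∀ n x, s n ((circle.{u}).pt n) x = Y.pt n)
    (s_right : ∀ n t, s n t (X.pt n) = Y.pt n) : smash circle X ⟶ Y :=
  smashDesc
    { app n := ↾(fun p => s n p.1 p.2)
      naturality _ _ θ := by
        ext ⟨t, x⟩
        exact (s_map θ t x).symm } s_left s_right

/-- Constructor for maps of spectra from their values on simplices. -/
def homMk {X Y : Spectrum.{u}} (f : ∀ k n, X.Simplex k n → Y.Simplex k n)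
    (f_map : ∀ {k m n} (θ : m ⟶ n) (x : X.Simplex k m),
      f k n ((X.level k).sset.map θ x) = (Y.level k).sset.map θ (f k m x))
    (f_pt : ∀ k n, f k n ((X.level k).pt n) = (Y.level k).pt n)
    (f_sus : ∀ {k n} (t : (circle.{u}).sset.obj n) (x : X.Simplex k n),
      f (k + 1) n (X.sus t x) = Y.sus t (f k n x)) : X ⟶ Y :=
  Hom.mk
    (fun k =>
      { hom :=
          { app n := ↾(f k n)
            naturality _ _ θ := by
              ext x
              exact f_map θ x }
        hom_pt := f_pt k })
    (fun _ => smash_hom_ext fun _ t x => f_sus t x)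

@[simp] lemma ap_homMk {X Y : Spectrum.{u}} (f : ∀ k n, X.Simplex k n → Y.Simplex k n)
    (f_map f_pt f_sus) {k n} (x : X.Simplex k n) :
    ap (homMk (X := X) (Y := Y) f f_map f_pt f_sus) x = f k n x := rfl

/-! ### Subspectra, products, equalizers -/

/-- A subspectrum of `X`. -/
structure Sub (X : Spectrum.{u}) where
  carrier : ∀ k n, Set (X.Simplex k n)
  map_mem : ∀ {k m n} (θ : m ⟶ n) {x}, x ∈ carrier k m → (X.level k).sset.map θ x ∈ carrier k n
  pt_mem : ∀ k n, (X.level k).pt n ∈ carrier k n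
  sus_mem : ∀ {k n} (t : (circle.{u}).sset.obj n) {x}, x ∈ carrier k n →
    X.sus t x ∈ carrier (k + 1) n

namespace Sub

variable {X Y : Spectrum.{u}}

/-- A subspectrum, regarded as a spectrum. -/
def toSpectrum (A : Sub X) : Spectrum.{u} where
  level k :=
    { sset :=
        { obj n := A.carrier k n
          map θ := ↾(fun x => ⟨(X.level k).sset.map θ x.1, A.map_mem θ x.2⟩)
          map_id _ := types_ext fun x => Subtype.ext (sset_map_id x.1)
          map_comp θ θ' := types_ext fun x => Subtype.ext (sset_map_comp θ θ' x.1) }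
      pt n := ⟨(X.level k).pt n, A.pt_mem k n⟩
      map_pt θ := Subtype.ext ((X.level k).map_pt θ) }
  str _ := strMk (fun _ t x => ⟨X.sus t x.1, A.sus_mem t x.2⟩)
    (fun θ t x => Subtype.ext (X.map_sus θ t x.1))
    (fun _ x => Subtype.ext (X.sus_pt_left x.1))
    (fun _ t => Subtype.ext (X.sus_pt_right t))

/-- The inclusion of a subspectrum. -/
def ι (A : Sub X) : A.toSpectrum ⟶ X :=
  homMk (fun _ _ x => x.1) (fun _ _ => rfl) (fun _ _ => rfl) (fun _ _ => rfl)

/-- A map of spectra with values in a subspectrum. -/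
def lift (A : Sub X) (f : Y ⟶ X) (hf : ∀ k n (y : Y.Simplex k n), ap f y ∈ A.carrier k n) :
    Y ⟶ A.toSpectrum :=
  homMk (fun k n y => ⟨ap f y, hf k n y⟩) (fun θ y => Subtype.ext (ap_map f θ y))
    (fun k n => Subtype.ext (ap_pt f k n)) (fun t y => Subtype.ext (ap_sus f t y))

@[simp] lemma lift_ι (A : Sub X) (f : Y ⟶ X) (hf) : A.lift f hf ≫ A.ι = f := rfl

lemma ι_injective (A : Sub X) {f g : Y ⟶ A.toSpectrum} (h : f ≫ A.ι = g ≫ A.ι) : f = g := by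
  ext k n y
  exact Subtype.ext (congrArg (fun φ : Y ⟶ X => ap φ y) h)

end Sub

/-- The product of a family of spectra, formed in each level and each simplicial degree. -/
def prod {I : Type u} (X : I → Spectrum.{u}) : Spectrum.{u} where
  level k :=
    { sset :=
        { obj n := ∀ i, (X i).Simplex k n
          map θ := ↾(fun x i => ((X i).level k).sset.map θ (x i))
          map_id _ := types_ext fun x => funext fun i => sset_map_id (x i)
          map_comp θ θ' := types_ext fun x => funext fun i => sset_map_comp θ θ' (x i) }
      pt n := fun i => ((X i).level k).pt n
      map_pt θ := funext fun i => ((X i).level k).map_pt θ }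
  str _ := strMk (fun _ t x i => (X i).sus t (x i))
    (fun θ t x => funext fun i => (X i).map_sus θ t (x i))
    (fun _ x => funext fun i => (X i).sus_pt_left (x i))
    (fun _ t => funext fun i => (X i).sus_pt_right t)

/-- The projections of a product. -/
def prodπ {I : Type u} (X : I → Spectrum.{u}) (i : I) : prod X ⟶ X i :=
  homMk (fun _ _ x => x i) (fun _ _ => rfl) (fun _ _ => rfl) (fun _ _ => rfl)

/-- The map into a product with given components. -/
def prodLift {I : Type u} {X : I → Spectrum.{u}} {Y : Spectrum.{u}} (f : ∀ i, Y ⟶ X i) :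
    Y ⟶ prod X :=
  homMk (fun _ _ y i => ap (f i) y) (fun θ y => funext fun i => ap_map (f i) θ y)
    (fun k n => funext fun i => ap_pt (f i) k n) (fun t y => funext fun i => ap_sus (f i) t y)

@[simp] lemma prodLift_π {I : Type u} {X : I → Spectrum.{u}} {Y : Spectrum.{u}}
    (f : ∀ i, Y ⟶ X i) (i : I) : prodLift f ≫ prodπ X i = f i := rfl

@[ext]
lemma prod_hom_ext {I : Type u} {X : I → Spectrum.{u}} {Y : Spectrum.{u}} {f g : Y ⟶ prod X}
    (h : ∀ i, f ≫ prodπ X i = g ≫ prodπ X i) : f = g := by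
  apply hom_ext
  intro k n y
  exact funext fun i => congrArg (fun φ : Y ⟶ X i => ap φ y) (h i)

/-- `prod X` is the categorical product. -/
def prodIsLimit {I : Type u} (X : I → Spectrum.{u}) :
    Limits.IsLimit (Limits.Fan.mk (prod X) (prodπ X)) :=
  Limits.Fan.IsLimit.mk _ (fun s => prodLift s.proj) (fun _ i => prodLift_π _ i)
    (fun _ _ h => prod_hom_ext fun i => h i)

/-- The equalizer of two maps of spectra, as a subspectrum of the source. -/
def eqSub {X Y : Spectrum.{u}} (f g : X ⟶ Y) : Sub X where
  carrier _ _ := {x | ap f x = ap g x}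
  map_mem θ x hx := by
    change ap f _ = ap g _
    rw [ap_map, ap_map]
    exact congrArg _ hx
  pt_mem k n := (ap_pt f k n).trans (ap_pt g k n).symm
  sus_mem t x hx := by
    change ap f _ = ap g _
    rw [ap_sus, ap_sus]
    exact congrArg _ hx

lemma eqSub_condition {X Y : Spectrum.{u}} (f g : X ⟶ Y) :
    (eqSub f g).ι ≫ f = (eqSub f g).ι ≫ g := by
  ext k n x
  exact x.2

/-- The universal property of the equalizer. -/
def eqLift {X Y W : Spectrum.{u}} {f g : X ⟶ Y} (h : W ⟶ X) (w : h ≫ f = h ≫ g) :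
    W ⟶ (eqSub f g).toSpectrum :=
  (eqSub f g).lift h (fun _ _ y => congrArg (fun φ : W ⟶ Y => ap φ y) w)

/-- `eqSub f g` is the categorical equalizer. -/
def eqIsLimit {X Y : Spectrum.{u}} (f g : X ⟶ Y) :
    Limits.IsLimit (Limits.Fork.ofι (eqSub f g).ι (eqSub_condition f g)) :=
  Limits.Fork.IsLimit.mk _ (fun s => eqLift s.ι s.condition) (fun _ => rfl)
    (fun _ _ h => (eqSub f g).ι_injective h)

/-! ### Cotensors and homotopy limits -/

/-- The simplicial mapping space: its `n`-simplices are the maps `Δ[n] × K ⟶ Y`. -/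
def mapSSet (K Y : SSet.{u}) : SSet.{u} where
  obj n := SSet.stdSimplex.obj n.unop ⊗ K ⟶ Y
  map θ := ↾(fun f => (SSet.stdSimplex.map θ.unop ▷ K) ≫ f)
  map_id n := types_ext fun f =>
    (congrArg (fun h => (h ▷ K) ≫ f) (CategoryTheory.Functor.map_id SSet.stdSimplex n.unop)).trans rfl
  map_comp θ θ' := types_ext fun f =>
    (congrArg (fun h => (h ▷ K) ≫ f)
      (CategoryTheory.Functor.map_comp SSet.stdSimplex θ'.unop θ.unop)).trans rfl

/-- The constant map at the base point. -/
def mapPt (A : SSet.{u}) (Y : PointedSSet.{u}) : A ⟶ Y.sset where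
  app n := ↾(fun _ => Y.pt n)
  naturality _ _ θ := types_ext fun _ => (Y.map_pt θ).symm

/-- The operator `n ⟶ m` that corresponds to an `m`-simplex of `Δ[n]`. -/
def operator {n m : SimplexCategoryᵒᵖ} (a : (SSet.stdSimplex.{u}.obj n.unop).obj m) : n ⟶ m :=
  (SSet.stdSimplex.objEquiv a).op

/-- The structure map of a cotensor sends `t ∧ f`, where `f : Δ[n] × K ⟶ Xₖ`, to the map
`Δ[n] × K ⟶ Xₖ₊₁`, `(a, y) ↦ σ (a^* t ∧ f (a, y))`. -/
def mapSus (X : Spectrum.{u}) (K : SSet.{u}) {k : ℕ} {n : SimplexCategoryᵒᵖ}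
    (t : (circle.{u}).sset.obj n) (f : SSet.stdSimplex.obj n.unop ⊗ K ⟶ (X.level k).sset) :
    SSet.stdSimplex.obj n.unop ⊗ K ⟶ (X.level (k + 1)).sset where
  app m := ↾(fun p => X.sus ((circle.{u}).sset.map (operator p.1) t) (f.app m p))
  naturality m m' θ := types_ext fun p => by
    refine Eq.trans ?_ (X.map_sus θ _ _).symm
    refine congrArg₂ X.sus ?_ (NatTrans.naturality_apply f θ p)
    rw [← sset_map_comp]
    rfl

/-- The cotensor `X^K` of a spectrum with a simplicial set: `(X^K)ₖ` is the pointed simplicial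
mapping space from `K` to `Xₖ`. -/
def cotensor (X : Spectrum.{u}) (K : SSet.{u}) : Spectrum.{u} where
  level k :=
    { sset := mapSSet K (X.level k).sset
      pt n := mapPt _ (X.level k)
      map_pt _ := rfl }
  str k := strMk (fun n t f => mapSus X K t f)
    (fun {m n} θ t f => by
      refine NatTrans.ext (funext fun l => types_ext fun p => ?_)
      change X.sus ((circle.{u}).sset.map (operator _) t) _ =
        X.sus ((circle.{u}).sset.map (operator p.1) ((circle.{u}).sset.map θ t)) _
      rw [← sset_map_comp]
      rfl)
    (fun n f => NatTrans.ext (funext fun l => types_ext fun p => by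
      change X.sus ((circle.{u}).sset.map (operator p.1) _) _ = _
      rw [(circle.{u}).map_pt]
      exact X.sus_pt_left _))
    (fun n t => NatTrans.ext (funext fun l => types_ext fun p => X.sus_pt_right _))

/-- Functoriality of the cotensor in the spectrum. -/
def cotensorMap {X Y : Spectrum.{u}} (φ : X ⟶ Y) (K : SSet.{u}) : cotensor X K ⟶ cotensor Y K :=
  homMk (fun k _ f => f ≫ (Hom.level φ k).hom) (fun _ _ => rfl)
    (fun k _ => NatTrans.ext (funext fun l => types_ext fun _ => ap_pt φ k l))
    (fun _ _ => NatTrans.ext (funext fun _ => types_ext fun _ => ap_sus φ _ _))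

/-- Functoriality of the cotensor in the simplicial set. -/
def cotensorPre (X : Spectrum.{u}) {K L : SSet.{u}} (j : K ⟶ L) : cotensor X L ⟶ cotensor X K :=
  homMk (fun _ n f => (SSet.stdSimplex.obj n.unop ◁ j) ≫ f) (fun _ _ => rfl)
    (fun _ _ => rfl) (fun _ _ => rfl)

lemma cotensorMap_id (X : Spectrum.{u}) (K : SSet.{u}) : cotensorMap (𝟙 X) K = 𝟙 _ := rfl

lemma cotensorMap_comp {X Y Z : Spectrum.{u}} (φ : X ⟶ Y) (ψ : Y ⟶ Z) (K : SSet.{u}) :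
    cotensorMap (φ ≫ ψ) K = cotensorMap φ K ≫ cotensorMap ψ K := rfl

lemma cotensorMap_pre {X Y : Spectrum.{u}} (φ : X ⟶ Y) {K L : SSet.{u}} (j : K ⟶ L) :
    cotensorMap φ L ≫ cotensorPre Y j = cotensorPre X j ≫ cotensorMap φ K := rfl

section Holim

variable {C : Type u} [SmallCategory C]

/-- The classifying space `B(C ↓ c)` of the category of objects over `c`. -/
abbrev overNerve (c : C) : SSet.{u} := nerve (Over c)

/-- The map `B(C ↓ c) ⟶ B(C ↓ d)` induced by `σ : c ⟶ d`. -/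
abbrev overNerveMap {c d : C} (σ : c ⟶ d) : overNerve c ⟶ overNerve d := nerveMap (Over.map σ)

/-- `∏_c X(c)^{B(C ↓ c)}`. -/
def holimSource (X : C ⥤ Spectrum.{u}) : Spectrum.{u} :=
  prod fun c : C => cotensor (X.obj c) (overNerve c)

/-- `∏_{σ : c ⟶ d} X(d)^{B(C ↓ c)}`. -/
def holimTarget (X : C ⥤ Spectrum.{u}) : Spectrum.{u} :=
  prod fun σ : Arrow C => cotensor (X.obj σ.right) (overNerve σ.left)

/-- The map `α`, with components `X(σ)^{B(C ↓ c)}`. -/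
def holimα (X : C ⥤ Spectrum.{u}) : holimSource X ⟶ holimTarget X :=
  prodLift fun σ : Arrow C =>
    prodπ (fun c : C => cotensor (X.obj c) (overNerve c)) σ.left ≫
      cotensorMap (X.map σ.hom) (overNerve σ.left)

/-- The map `β`, with components `X(d)^{B(C ↓ σ)}`. -/
def holimβ (X : C ⥤ Spectrum.{u}) : holimSource X ⟶ holimTarget X :=
  prodLift fun σ : Arrow C =>
    prodπ (fun c : C => cotensor (X.obj c) (overNerve c)) σ.right ≫
      cotensorPre (X.obj σ.right) (overNerveMap σ.hom)

/-- The homotopy limit of a diagram of spectra: the equalizer of `α` and `β`. -/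
def holim (X : C ⥤ Spectrum.{u}) : Spectrum.{u} :=
  (eqSub (holimα X) (holimβ X)).toSpectrum

/-- The inclusion of the homotopy limit into `∏_c X(c)^{B(C ↓ c)}`. -/
def holimι (X : C ⥤ Spectrum.{u}) : holim X ⟶ holimSource X :=
  (eqSub (holimα X) (holimβ X)).ι

/-- The map `∏_c X(c)^{B(C ↓ c)} ⟶ ∏_c Y(c)^{B(C ↓ c)}` induced by a map of diagrams. -/
def holimSourceMap {X Y : C ⥤ Spectrum.{u}} (η : X ⟶ Y) : holimSource X ⟶ holimSource Y :=
  prodLift fun c : C => prodπ (fun c : C => cotensor (X.obj c) (overNerve c)) c ≫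
    cotensorMap (η.app c) (overNerve c)

/-- The map of homotopy limits induced by a map of diagrams. -/
def holimMap {X Y : C ⥤ Spectrum.{u}} (η : X ⟶ Y) : holim X ⟶ holim Y :=
  eqLift (holimι X ≫ holimSourceMap η) (by
    refine prod_hom_ext fun σ => ?_
    have h : holimι X ≫ holimα X ≫ prodπ _ σ = holimι X ≫ holimβ X ≫ prodπ _ σ :=
      congrArg (fun φ => φ ≫ prodπ _ σ) (eqSub_condition (holimα X) (holimβ X))
    have h' := congrArg (fun φ => φ ≫ cotensorMap (η.app σ.right) (overNerve σ.left)) h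
    have hn := η.naturality σ.hom
    refine Eq.trans ?_ (h'.trans ?_)
    · change (holimι X ≫ prodπ _ σ.left) ≫
          cotensorMap (η.app σ.left ≫ Y.map σ.hom) (overNerve σ.left) =
        (holimι X ≫ prodπ _ σ.left) ≫
          cotensorMap (X.map σ.hom ≫ η.app σ.right) (overNerve σ.left)
      rw [hn]
    · rfl)

/-- The homotopy limit as a functor of the diagram. -/
def holimFunctor (C : Type u) [SmallCategory C] : (C ⥤ Spectrum.{u}) ⥤ Spectrum.{u} where
  obj X := holim X
  map η := holimMap η
  map_id _ := rfl
  map_comp _ _ := rfl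

end Holim

end Spectrum

open Spectrum

/-! ### `G`-spectra and discrete `G`-spectra -/

/-- A `G`-spectrum: a spectrum with a (left) action of `G` by maps of spectra. -/
abbrev GSpectrum (G : Type u) [Group G] : Type (u + 1) := Action Spectrum.{u} G

namespace GSpectrum

section Action

variable {G : Type u} [Group G]

/-- The action of `g` on a simplex of a `G`-spectrum. -/
def act (Y : GSpectrum G) (g : G) {k : ℕ} {n : SimplexCategoryᵒᵖ} (y : Y.V.Simplex k n) :
    Y.V.Simplex k n :=
  ap (X := Y.V) (Y := Y.V) (Y.ρ g) y

lemma act_one (Y : GSpectrum G) {k n} (y : Y.V.Simplex k n) : Y.act 1 y = y :=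
  congrArg (fun φ : Y.V ⟶ Y.V => ap φ y) (map_one Y.ρ)

lemma act_mul (Y : GSpectrum G) (g h : G) {k n} (y : Y.V.Simplex k n) :
    Y.act (g * h) y = Y.act g (Y.act h y) :=
  congrArg (fun φ : Y.V ⟶ Y.V => ap φ y) (map_mul Y.ρ g h)

lemma act_pt (Y : GSpectrum G) (g : G) (k n) :
    Y.act g ((Y.V.level k).pt n) = (Y.V.level k).pt n :=
  ap_pt (X := Y.V) (Y := Y.V) (Y.ρ g) k n

lemma act_map (Y : GSpectrum G) (g : G) {k m n} (θ : m ⟶ n) (y : Y.V.Simplex k m) :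
    Y.act g ((Y.V.level k).sset.map θ y) = (Y.V.level k).sset.map θ (Y.act g y) :=
  ap_map (X := Y.V) (Y := Y.V) (Y.ρ g) θ y

lemma act_sus (Y : GSpectrum G) (g : G) {k n} (t : (circle.{u}).sset.obj n)
    (y : Y.V.Simplex k n) : Y.act g (Y.V.sus t y) = Y.V.sus t (Y.act g y) :=
  ap_sus (X := Y.V) (Y := Y.V) (Y.ρ g) t y

lemma ap_act {Y Z : GSpectrum G} (φ : Y ⟶ Z) (g : G) {k n} (y : Y.V.Simplex k n) :
    ap φ.hom (Y.act g y) = Z.act g (ap φ.hom y) :=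
  congrArg (fun ψ : Y.V ⟶ Z.V => ap ψ y) (φ.comm g)

/-- The fixed point spectrum `Y^H` of a subgroup `H`. -/
def fixedPoints (Y : GSpectrum G) (H : Subgroup G) : Sub Y.V where
  carrier _ _ := {y | ∀ h ∈ H, Y.act h y = y}
  map_mem θ y hy h hh := by rw [act_map, hy h hh]
  pt_mem k n h _ := Y.act_pt h k n
  sus_mem t y hy h hh := by rw [act_sus, hy h hh]

/-- The homotopy limit, formed in spectra, of a diagram of `G`-spectra is a `G`-spectrum:
`g` acts through the automorphisms of the `X(c)`. -/
def holim {C : Type u} [SmallCategory C] (X : C ⥤ GSpectrum G) : GSpectrum G where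
  V := Spectrum.holim (X ⋙ Action.forget Spectrum.{u} G)
  ρ :=
    { toFun g := holimMap
        { app c := (X.obj c).ρ g
          naturality _ _ σ := ((X.map σ).comm g).symm }
      map_one' := by
        refine Eq.trans (congrArg holimMap (NatTrans.ext (funext fun c => ?_)))
          ((holimFunctor C).map_id _)
        exact map_one (X.obj c).ρ
      map_mul' g h := by
        refine Eq.trans (congrArg holimMap (NatTrans.ext (funext fun c => ?_)))
          ((holimFunctor C).map_comp
            (X := X ⋙ Action.forget Spectrum.{u} G)
            (Y := X ⋙ Action.forget Spectrum.{u} G)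
            (Z := X ⋙ Action.forget Spectrum.{u} G)
            { app c := (X.obj c).ρ h
              naturality _ _ σ := ((X.map σ).comm h).symm }
            { app c := (X.obj c).ρ g
              naturality _ _ σ := ((X.map σ).comm g).symm })
        exact map_mul (X.obj c).ρ g h }

end Action

variable {G : Type u} [Group G] [TopologicalSpace G]

/-- A `G`-spectrum is discrete if the action maps `G × (Yₖ)ₙ ⟶ (Yₖ)ₙ` are continuous, where
`(Yₖ)ₙ` has the discrete topology. -/
def isDiscrete (G : Type u) [Group G] [TopologicalSpace G] : ObjectProperty (GSpectrum G) :=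
  fun Y => ∀ k n, letI : TopologicalSpace (Y.V.Simplex k n) := ⊥
    Continuous (fun p : G × Y.V.Simplex k n => Y.act p.1 p.2)

/-- The spectrum `colim_N Y^N`, where `N` runs over the open normal subgroups of `G`, realised as
the union of the subspectra `Y^N` of `Y`; see `colimFixedIsColimit`. -/
def colimFixedSub (Y : GSpectrum G) : Sub Y.V where
  carrier k n := ⋃ N : OpenNormalSubgroup G, (Y.fixedPoints N.toSubgroup).carrier k n
  map_mem θ y hy := by
    obtain ⟨N, hN⟩ := Set.mem_iUnion.1 hy
    exact Set.mem_iUnion.2 ⟨N, (Y.fixedPoints N.toSubgroup).map_mem θ hN⟩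
  pt_mem k n := Set.mem_iUnion.2
    ⟨{ toSubgroup := ⊤, isOpen' := isOpen_univ, isNormal' := inferInstance },
      (Y.fixedPoints ⊤).pt_mem k n⟩
  sus_mem t y hy := by
    obtain ⟨N, hN⟩ := Set.mem_iUnion.1 hy
    exact Set.mem_iUnion.2 ⟨N, (Y.fixedPoints N.toSubgroup).sus_mem t hN⟩

/-- The diagram `N ↦ Y^N` of fixed point spectra, with the inclusions `Y^N ⟶ Y^{N'}` for
`N' ≤ N`. -/
def fixedDiagram (Y : GSpectrum G) : (OpenNormalSubgroup G)ᵒᵖ ⥤ Spectrum.{u} where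
  obj N := (Y.fixedPoints N.unop.toSubgroup).toSpectrum
  map {N N'} i := (Y.fixedPoints N'.unop.toSubgroup).lift (Y.fixedPoints N.unop.toSubgroup).ι
    (fun _ _ y h hh => y.2 h (leOfHom i.unop hh))
  map_id _ := rfl
  map_comp _ _ := rfl

/-- The inclusions of the `Y^N` into their union. -/
def colimFixedCocone (Y : GSpectrum G) : Limits.Cocone (fixedDiagram Y) where
  pt := (colimFixedSub Y).toSpectrum
  ι :=
    { app N := (colimFixedSub Y).lift (Y.fixedPoints N.unop.toSubgroup).ι
        (fun _ _ y => Set.mem_iUnion.2 ⟨N.unop, y.2⟩)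
      naturality _ _ _ := rfl }

/-- A leg of a cocone under `N ↦ Y^N`. -/
def leg {Y : GSpectrum G} (s : Limits.Cocone (fixedDiagram Y)) (N : OpenNormalSubgroup G) :
    (Y.fixedPoints N.toSubgroup).toSpectrum ⟶ s.pt :=
  s.ι.app (op N)

lemma leg_eq {Y : GSpectrum G} (s : Limits.Cocone (fixedDiagram Y)) {k n}
    (y : Y.V.Simplex k n) {N N' : OpenNormalSubgroup G}
    (h : y ∈ (Y.fixedPoints N.toSubgroup).carrier k n)
    (h' : y ∈ (Y.fixedPoints N'.toSubgroup).carrier k n) :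
    ap (leg s N) (k := k) (n := n) ⟨y, h⟩ = ap (leg s N') (k := k) (n := n) ⟨y, h'⟩ := by
  have e₁ : (fixedDiagram Y).map (homOfLE (inf_le_left : N ⊓ N' ≤ N)).op ≫ leg s (N ⊓ N') =
    leg s N := s.w _
  have e₂ : (fixedDiagram Y).map (homOfLE (inf_le_right : N ⊓ N' ≤ N')).op ≫ leg s (N ⊓ N') =
    leg s N' := s.w _
  rw [← e₁, ← e₂]
  rfl

/-- The map out of the union induced by a cocone, on simplices. -/
def descFun {Y : GSpectrum G} (s : Limits.Cocone (fixedDiagram Y)) {k n}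
    (y : (colimFixedSub Y).toSpectrum.Simplex k n) : s.pt.Simplex k n :=
  ap (leg s (Set.mem_iUnion.1 y.2).choose) (k := k) (n := n)
    ⟨y.1, (Set.mem_iUnion.1 y.2).choose_spec⟩

lemma descFun_eq {Y : GSpectrum G} (s : Limits.Cocone (fixedDiagram Y)) {k n}
    (y : (colimFixedSub Y).toSpectrum.Simplex k n) (N : OpenNormalSubgroup G)
    (h : y.1 ∈ (Y.fixedPoints N.toSubgroup).carrier k n) :
    descFun s y = ap (leg s N) (k := k) (n := n) ⟨y.1, h⟩ :=
  leg_eq s _ _ _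

/-- The map out of the union induced by a cocone. -/
def colimFixedDesc {Y : GSpectrum G} (s : Limits.Cocone (fixedDiagram Y)) :
    (colimFixedSub Y).toSpectrum ⟶ s.pt :=
  homMk (fun _ _ y => descFun s y)
    (fun {k m n} θ y => by
      obtain ⟨N, hN⟩ := Set.mem_iUnion.1 y.2
      exact (descFun_eq s _ N ((Y.fixedPoints N.toSubgroup).map_mem θ hN)).trans
        ((ap_map (leg s N) θ (⟨y.1, hN⟩ :
          (Y.fixedPoints N.toSubgroup).toSpectrum.Simplex k m)).trans
        (congrArg _ (descFun_eq s y N hN).symm)))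
    (fun k n => by
      obtain ⟨N, -⟩ := Set.mem_iUnion.1 ((colimFixedSub Y).pt_mem k n)
      exact (descFun_eq s _ N ((Y.fixedPoints N.toSubgroup).pt_mem k n)).trans
        (ap_pt (leg s N) k n))
    (fun {k n} t y => by
      obtain ⟨N, hN⟩ := Set.mem_iUnion.1 y.2
      exact (descFun_eq s _ N ((Y.fixedPoints N.toSubgroup).sus_mem t hN)).trans
        ((ap_sus (leg s N) t (⟨y.1, hN⟩ :
          (Y.fixedPoints N.toSubgroup).toSpectrum.Simplex k n)).trans
        (congrArg _ (descFun_eq s y N hN).symm)))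

/-- The union of the `Y^N` is their colimit in the category of spectra. -/
def colimFixedIsColimit (Y : GSpectrum G) : Limits.IsColimit (colimFixedCocone Y) where
  desc s := colimFixedDesc s
  fac s N := Spectrum.hom_ext fun k n y =>
    descFun_eq s (ap ((colimFixedCocone Y).ι.app N) y) N.unop y.2
  uniq s f hf := Spectrum.hom_ext fun k n y => by
    obtain ⟨N, hN⟩ := Set.mem_iUnion.1 y.2
    refine Eq.trans ?_ (descFun_eq s y N hN).symm
    exact congrArg (fun φ => ap φ (k := k) (n := n)
      (⟨y.1, hN⟩ : (Y.fixedPoints N.toSubgroup).toSpectrum.Simplex k n)) (hf (op N))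

lemma act_mem_colimFixed (Y : GSpectrum G) (g : G) {k n} {y : Y.V.Simplex k n}
    (hy : y ∈ (colimFixedSub Y).carrier k n) : Y.act g y ∈ (colimFixedSub Y).carrier k n := by
  obtain ⟨N, hN⟩ := Set.mem_iUnion.1 hy
  refine Set.mem_iUnion.2 ⟨N, fun h hh => ?_⟩
  have hc : g⁻¹ * h * g ∈ N.toSubgroup := by
    simpa using N.isNormal'.conj_mem h hh g⁻¹
  rw [← act_mul, show h * g = g * (g⁻¹ * h * g) by group, act_mul, hN _ hc]

/-- `colim_N Y^N` as a `G`-spectrum; the action is the one for which `Y^N ⟶ colim_N Y^N` is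
equivariant for every `N`. -/
def colimFixedG (Y : GSpectrum G) : GSpectrum G where
  V := (colimFixedSub Y).toSpectrum
  ρ :=
    { toFun g := (colimFixedSub Y).lift ((colimFixedSub Y).ι ≫ Y.ρ g)
        (fun _ _ y => Y.act_mem_colimFixed g y.2)
      map_one' := by
        apply Spectrum.hom_ext
        intro k n y
        exact Subtype.ext (Y.act_one y.1)
      map_mul' g h := by
        apply Spectrum.hom_ext
        intro k n y
        exact Subtype.ext (Y.act_mul g h y.1) }

lemma isDiscrete_colimFixedG [IsTopologicalGroup G] (Y : GSpectrum G) :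
    isDiscrete G Y.colimFixedG := by
  intro k n
  let _ : TopologicalSpace (Y.colimFixedG.V.Simplex k n) := ⊥
  have _ : DiscreteTopology (Y.colimFixedG.V.Simplex k n) := ⟨rfl⟩
  rw [continuous_prod_of_discrete_right]
  intro y
  obtain ⟨N, hN⟩ := Set.mem_iUnion.1 y.2
  refine continuous_discrete_rng.2 fun z => isOpen_iff_mem_nhds.2 fun g hg => ?_
  have hopen : IsOpen ((fun x : G => g⁻¹ * x) ⁻¹' (N.toSubgroup : Set G)) :=
    N.isOpen'.preimage (continuous_const_mul g⁻¹)
  refine Filter.mem_of_superset (hopen.mem_nhds (by simp)) fun x hx => ?_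
  refine Eq.trans (Subtype.ext ?_) (Set.mem_singleton_iff.1 hg)
  change Y.act x y.1 = Y.act g y.1
  rw [show x = g * (g⁻¹ * x) by group, act_mul, hN _ hx]

end GSpectrum

/-- The category of discrete `G`-spectra and `G`-equivariant maps of spectra. -/
abbrev DiscreteGSpectrum (G : Type u) [Group G] [TopologicalSpace G] : Type (u + 1) :=
  (GSpectrum.isDiscrete G).FullSubcategory

/-- The discrete `G`-spectrum `colim_N Y^N` of a `G`-spectrum `Y`. -/
def GSpectrum.colimFixed {G : Type u} [Group G] [TopologicalSpace G] [IsTopologicalGroup G]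
    (Y : GSpectrum G) : DiscreteGSpectrum G :=
  ⟨Y.colimFixedG, Y.isDiscrete_colimFixedG⟩

/-- The homotopy limit, formed in spectra, of a diagram of discrete `G`-spectra. It is a
`G`-spectrum, but need not be discrete. -/
def DiscreteGSpectrum.holim {G : Type u} [Group G] [TopologicalSpace G] {C : Type u}
    [SmallCategory C] (X : C ⥤ DiscreteGSpectrum G) : GSpectrum G :=
  GSpectrum.holim (X ⋙ (GSpectrum.isDiscrete G).ι)

/-! ### The site of finite discrete `G`-sets -/

/-- The category of finite discrete `G`-sets: finite sets with a continuous action of `G`. -/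
abbrev FinGSet (G : Type u) [Group G] [TopologicalSpace G] : Type (u + 1) :=
  ContAction FintypeCat.{u} G

namespace FinGSet

variable {G : Type u} [Group G] [TopologicalSpace G]

/-- The underlying set of a finite discrete `G`-set. -/
abbrev El (S : FinGSet G) : Type u := S.obj.V.obj

/-- The action of `g` on an element. -/
def act (S : FinGSet G) (g : G) (s : S.El) : S.El :=
  (S.obj.ρ g : S.obj.V ⟶ S.obj.V).hom s

/-- The underlying function of an equivariant map. -/
def fn {S T : FinGSet G} (f : S ⟶ T) (s : S.El) : T.El := f.hom.hom.hom s

lemma act_one (S : FinGSet G) (s : S.El) : S.act 1 s = s :=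
  congrArg (fun φ : S.obj.V ⟶ S.obj.V => φ.hom s) (map_one S.obj.ρ)

lemma act_mul (S : FinGSet G) (g h : G) (s : S.El) : S.act (g * h) s = S.act g (S.act h s) :=
  congrArg (fun φ : S.obj.V ⟶ S.obj.V => φ.hom s) (map_mul S.obj.ρ g h)

lemma fn_act {S T : FinGSet G} (f : S ⟶ T) (g : G) (s : S.El) :
    fn f (S.act g s) = T.act g (fn f s) :=
  congrArg (fun φ : S.obj.V ⟶ T.obj.V => φ.hom s) (f.hom.comm g)

lemma continuous_act (S : FinGSet G) (s : S.El) :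
    @Continuous G S.El _ ⊥ (fun g => S.act g s) := by
  let _ : TopologicalSpace S.El := ⊥
  exact ((Action.isContinuous_def S.obj).1 S.property).comp
    (Continuous.prodMk continuous_id (continuous_const (y := s)))

/-- The fibre product of finite discrete `G`-sets. -/
def pull {S T W : FinGSet G} (f : T ⟶ S) (h : W ⟶ S) : FinGSet G where
  obj :=
    { V := FintypeCat.of {p : T.El × W.El // fn f p.1 = fn h p.2}
      ρ :=
        { toFun g := FintypeCat.homMk (fun p => ⟨(T.act g p.1.1, W.act g p.1.2), by
            rw [fn_act, fn_act, p.2]⟩)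
          map_one' := FintypeCat.hom_ext _ _ fun p =>
            Subtype.ext (Prod.ext (T.act_one p.1.1) (W.act_one p.1.2))
          map_mul' g g' := FintypeCat.hom_ext _ _ fun p =>
            Subtype.ext (Prod.ext (T.act_mul g g' p.1.1) (W.act_mul g g' p.1.2)) } }
  property := by
    rw [Action.isContinuous_def]
    let Z := {p : T.El × W.El // fn f p.1 = fn h p.2}
    let _ : TopologicalSpace Z := ⊥
    have _ : DiscreteTopology Z := ⟨rfl⟩
    let a (g : G) (p : Z) : Z := ⟨(T.act g p.1.1, W.act g p.1.2), by rw [fn_act, fn_act, p.2]⟩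
    change Continuous (fun x : G × Z => a x.1 x.2)
    refine continuous_prod_of_discrete_right.2 fun p => ?_
    have h₁ := T.continuous_act p.1.1
    have h₂ := W.continuous_act p.1.2
    refine continuous_discrete_rng.2 fun q => ?_
    have e : (fun g : G => a g p) ⁻¹' {q} =
        (fun g => T.act g p.1.1) ⁻¹' {q.1.1} ∩ (fun g => W.act g p.1.2) ⁻¹' {q.1.2} := by
      ext g
      constructor
      · intro hg
        have hg' : a g p = q := hg
        exact ⟨congrArg (fun z : Z => z.1.1) hg', congrArg (fun z : Z => z.1.2) hg'⟩
      · intro hg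
        exact Subtype.ext (Prod.ext hg.1 hg.2)
    refine Eq.mpr (congrArg IsOpen e) (IsOpen.inter ?_ ?_)
    · exact @IsOpen.preimage G T.El _ ⊥ _ h₁ _ trivial
    · exact @IsOpen.preimage G W.El _ ⊥ _ h₂ _ trivial

/-- The first projection of the fibre product. -/
def pullFst {S T W : FinGSet G} (f : T ⟶ S) (h : W ⟶ S) : pull f h ⟶ T :=
  ObjectProperty.homMk { hom := FintypeCat.homMk (fun p => p.1.1), comm := fun _ => rfl }

/-- The second projection of the fibre product. -/
def pullSnd {S T W : FinGSet G} (f : T ⟶ S) (h : W ⟶ S) : pull f h ⟶ W :=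
  ObjectProperty.homMk { hom := FintypeCat.homMk (fun p => p.1.2), comm := fun _ => rfl }

lemma pull_condition {S T W : FinGSet G} (f : T ⟶ S) (h : W ⟶ S) :
    pullFst f h ≫ f = pullSnd f h ≫ h := by
  apply ObjectProperty.hom_ext
  apply Action.hom_ext
  exact FintypeCat.hom_ext _ _ fun p => p.2

/-- The topology on finite discrete `G`-sets: a sieve on `S` is covering if it contains a jointly
surjective family of maps to `S`. -/
def topology (G : Type u) [Group G] [TopologicalSpace G] : GrothendieckTopology (FinGSet G) where
  sieves S := {R | ∀ s : S.El, ∃ (T : FinGSet G) (f : T ⟶ S) (t : T.El), R f ∧ fn f t = s}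
  top_mem' S s := ⟨S, 𝟙 S, s, trivial, rfl⟩
  pullback_stable' S T R f hR t := by
    obtain ⟨W, h, w, hRh, hw⟩ := hR (fn f t)
    refine ⟨pull f h, pullFst f h, ⟨(t, w), hw.symm⟩, ?_, rfl⟩
    change R (pullFst f h ≫ f)
    rw [pull_condition]
    exact R.downward_closed hRh _
  transitive' S R hR R' h s := by
    obtain ⟨T, f, t, hf, rfl⟩ := hR s
    obtain ⟨W, k, w, hk, rfl⟩ := h hf t
    exact ⟨W, k ≫ f, w, hk, rfl⟩

end FinGSet

/-! ### Presheaves of spectra on finite discrete `G`-sets -/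

section Presheaves

variable {G : Type u} [Group G] [TopologicalSpace G]

/-- The spectrum `Hom_G(S, Y)`, with simplices `Hom_G(S, Y)ₖ,ₙ = Hom_G(S, (Yₖ)ₙ)`, as a
subspectrum of the product of copies of `Y` indexed by the elements of `S`. -/
def homGSub (S : FinGSet G) (Y : GSpectrum G) : Sub (Spectrum.prod fun _ : S.El => Y.V) where
  carrier k n := Set.ofPred fun f : S.El → Y.V.Simplex k n =>
    ∀ (g : G) (s : S.El), f (S.act g s) = Y.act g (f s)
  map_mem θ f hf g s := (congrArg _ (hf g s)).trans (Y.act_map g θ (f s)).symm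
  pt_mem k n g _ := (Y.act_pt g k n).symm
  sus_mem t f hf g s := (congrArg _ (hf g s)).trans (Y.act_sus g t (f s)).symm

/-- The presheaf of spectra `Hom_G(-, Y)` on finite discrete `G`-sets, as a functor of `Y`. -/
def homG (G : Type u) [Group G] [TopologicalSpace G] :
    GSpectrum G ⥤ (FinGSet G)ᵒᵖ ⥤ Spectrum.{u} where
  obj Y :=
    { obj S := (homGSub S.unop Y).toSpectrum
      map {S T} φ := (homGSub T.unop Y).lift
        (prodLift fun t => (homGSub S.unop Y).ι ≫ prodπ _ (FinGSet.fn φ.unop t))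
        (fun _ _ f g t =>
          (congrArg f.1 (FinGSet.fn_act φ.unop g t)).trans (f.2 g (FinGSet.fn φ.unop t)))
      map_id _ := rfl
      map_comp _ _ := rfl }
  map {Y Z} ψ :=
    { app S := (homGSub S.unop Z).lift
        (prodLift fun s => (homGSub S.unop Y).ι ≫ prodπ _ s ≫ ψ.hom)
        (fun _ _ f g s => (congrArg (ap ψ.hom) (f.2 g s)).trans (GSpectrum.ap_act ψ g (f.1 s)))
      naturality _ _ _ := rfl }
  map_id _ := rfl
  map_comp _ _ := rfl

/-- The presheaf `Hom_G(-, Y)` associated to a discrete `G`-spectrum `Y`. -/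
abbrev discreteHomG (G : Type u) [Group G] [TopologicalSpace G] :
    DiscreteGSpectrum G ⥤ (FinGSet G)ᵒᵖ ⥤ Spectrum.{u} :=
  (GSpectrum.isDiscrete G).ι ⋙ homG G

/-- The homotopy limit of a diagram of presheaves of spectra, formed objectwise:
`(holim P)(S) = holim (P(S))`. -/
def holimPresheaf {C : Type u} [SmallCategory C] (P : C ⥤ (FinGSet G)ᵒᵖ ⥤ Spectrum.{u}) :
    (FinGSet G)ᵒᵖ ⥤ Spectrum.{u} :=
  P.flip ⋙ holimFunctor C

end Presheaves

end

/-!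
Everything reduces to the description of maps into `Hom_G(S, Y)`: a map of spectra
`E ⟶ Hom_G(S, Y)` is a `G`-equivariant function from `S` to the `G`-set of maps `E ⟶ Y`.

* Equivariant functions on `S` glue along jointly surjective families, so `Hom_G(-, Y)` is a sheaf
  for every `G`-spectrum `Y`.
* The kernel `N` of the action on the finite set `S` is open and normal, and it fixes `S` pointwise,
  so an equivariant function on `S` takes its values in `Y^N`. Hence `Hom_G(-, Y)` does not change
  when `Y` is replaced by `colim_N Y^N`.
* An `n`-simplex of a homotopy limit is a compatible family of maps `Δ[n] × B(C ↓ c) ⟶ X(c)`, and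
  equivariant functions into such families are families of maps into `Hom_G(S, X(c))`; so
  `Hom_G(S, -)` commutes with homotopy limits.
-/

noncomputable section

namespace Spectrum

lemma isIso_of_bijective {X Y : Spectrum.{u}} (f : X ⟶ Y)
    (hf : ∀ k n, Function.Bijective (ap f : X.Simplex k n → Y.Simplex k n)) : IsIso f := by
  let e (k : ℕ) (n : SimplexCategoryᵒᵖ) : X.Simplex k n ≃ Y.Simplex k n :=
    Equiv.ofBijective _ (hf k n)
  have he {k n} (y : Y.Simplex k n) : ap f ((e k n).symm y) = y := (e k n).apply_symm_apply y
  refine ⟨homMk (fun k n => (e k n).symm) (fun θ y => (hf _ _).1 ?_) (fun k n => (hf _ _).1 ?_)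
    (fun t y => (hf _ _).1 ?_), ?_, ?_⟩
  · rw [he, ap_map, he]
  · rw [he, ap_pt]
  · rw [he, ap_sus, he]
  · ext k n x
    exact (e k n).symm_apply_apply x
  · ext k n y
    exact he y

section HolimSimplex

variable {C : Type u} [SmallCategory C] {X : C ⥤ Spectrum.{u}} {k : ℕ} {n : SimplexCategoryᵒᵖ}

/-- The component `Δ[n] × B(C ↓ c) ⟶ X(c)ₖ` of an `n`-simplex of `(holim X)ₖ`. -/
def holimComponent (x : (holim X).Simplex k n) (c : C) :
    SSet.stdSimplex.obj n.unop ⊗ overNerve c ⟶ ((X.obj c).level k).sset :=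
  x.1 c

lemma holim_simplex_ext {x y : (holim X).Simplex k n}
    (h : ∀ c, holimComponent x c = holimComponent y c) : x = y :=
  Subtype.ext (funext h)

lemma holimComponent_comp_map (x : (holim X).Simplex k n) {c d : C} (σ : c ⟶ d) :
    holimComponent x c ≫ (Hom.level (X.map σ) k).hom =
      (SSet.stdSimplex.obj n.unop ◁ overNerveMap σ) ≫ holimComponent x d :=
  congrFun x.2 (Arrow.mk σ)

/-- The simplex of a homotopy limit with given compatible components. -/
def holimSimplexMk
    (x : ∀ c, SSet.stdSimplex.obj n.unop ⊗ overNerve c ⟶ ((X.obj c).level k).sset)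
    (hx : ∀ {c d : C} (σ : c ⟶ d), x c ≫ (Hom.level (X.map σ) k).hom =
      (SSet.stdSimplex.obj n.unop ◁ overNerveMap σ) ≫ x d) : (holim X).Simplex k n :=
  ⟨x, funext fun σ => hx σ.hom⟩

end HolimSimplex

end Spectrum

open Spectrum

namespace GSpectrum

/-- The equivariant inclusion `colim_N Y^N ⟶ Y`. -/
def colimFixedι {G : Type u} [Group G] [TopologicalSpace G] (Y : GSpectrum G) :
    Y.colimFixedG ⟶ Y where
  hom := (colimFixedSub Y).ι
  comm _ := rfl

/-- The action of `g` on the values of a diagram of `G`-spectra, as a map of diagrams of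
spectra. -/
def diagramAct {G : Type u} [Group G] {C : Type u} [SmallCategory C]
    (X : C ⥤ GSpectrum G) (g : G) :
    X ⋙ Action.forget Spectrum.{u} G ⟶ X ⋙ Action.forget Spectrum.{u} G where
  app c := (X.obj c).ρ g
  naturality _ _ σ := ((X.map σ).comm g).symm

end GSpectrum

variable {G : Type u} [Group G] [TopologicalSpace G]

namespace FinGSet

/-- The kernel of the action of `G` on a finite discrete `G`-set, which is open because it is a
finite intersection of stabilizers. -/
def actionKernel (S : FinGSet G) : OpenNormalSubgroup G where
  toSubgroup := MonoidHom.ker (S.obj.ρ : G →* End S.obj.V)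
  isOpen' := by
    have hker : ((MonoidHom.ker (S.obj.ρ : G →* End S.obj.V) : Subgroup G) : Set G) =
        ⋂ s : S.El, (fun g => S.act g s) ⁻¹' {s} := by
      ext g
      simp only [Set.mem_iInter]
      exact ⟨fun hg s => congrArg (fun φ : S.obj.V ⟶ S.obj.V => φ.hom s) hg,
        fun hg => FintypeCat.hom_ext _ _ hg⟩
    have hopen (s : S.El) : IsOpen ((fun g => S.act g s) ⁻¹' {s}) :=
      @IsOpen.preimage G S.El _ ⊥ _ (S.continuous_act s) _ trivial
    change IsOpen ((MonoidHom.ker (S.obj.ρ : G →* End S.obj.V) : Subgroup G) : Set G)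
    rw [hker]
    exact isOpen_iInter_of_finite hopen

lemma act_eq_of_mem_actionKernel {S : FinGSet G} {g : G} (hg : g ∈ S.actionKernel.toSubgroup)
    (s : S.El) : S.act g s = s :=
  congrArg (fun φ : S.obj.V ⟶ S.obj.V => φ.hom s) hg

lemma existsUnique_glue {S : FinGSet G} {R : Sieve S} (hR : R ∈ topology G S) {A : Type*}
    (v : ∀ ⦃T : FinGSet G⦄ (f : T ⟶ S), R f → T.El → A)
    (hv : ∀ ⦃T W : FinGSet G⦄ (f : T ⟶ S) (h : W ⟶ S) (hf : R f) (hh : R h) (t : T.El) (w : W.El),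
      fn f t = fn h w → v f hf t = v h hh w) :
    ∃! a : S.El → A, ∀ ⦃T : FinGSet G⦄ (f : T ⟶ S) (hf : R f) (t : T.El),
      a (fn f t) = v f hf t := by
  choose T f t hf hft using hR
  refine ⟨fun s => v (f s) (hf s) (t s), fun W h hh w => hv _ _ _ _ _ _ (hft _), fun a ha => ?_⟩
  funext s
  rw [← ha, hft]

end FinGSet

namespace homG

variable {S : (FinGSet G)ᵒᵖ} {Y : GSpectrum G} {E : Spectrum.{u}}

/-- Evaluation `Hom_G(S, Y) ⟶ Y` at an element of `S`. -/
def eval (Y : GSpectrum G) (s : S.unop.El) : ((homG G).obj Y).obj S ⟶ Y.V :=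
  (homGSub S.unop Y).ι ≫ prodπ _ s

lemma map_eval {T : (FinGSet G)ᵒᵖ} (φ : S ⟶ T) (t : T.unop.El) :
    ((homG G).obj Y).map φ ≫ eval Y t = eval Y (FinGSet.fn φ.unop t) :=
  rfl

lemma eval_act (g : G) (s : S.unop.El) : eval Y (S.unop.act g s) = eval Y s ≫ Y.ρ g := by
  ext k n f
  exact f.2 g s

lemma hom_ext {φ ψ : E ⟶ ((homG G).obj Y).obj S} (h : ∀ s, φ ≫ eval Y s = ψ ≫ eval Y s) : φ = ψ :=
  (homGSub S.unop Y).ι_injective (prod_hom_ext h)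

/-- The map of spectra `E ⟶ Hom_G(S, Y)` given by an equivariant function from `S` to the maps
`E ⟶ Y`. -/
def lift (v : S.unop.El → (E ⟶ Y.V)) (hv : ∀ g s, v (S.unop.act g s) = v s ≫ Y.ρ g) :
    E ⟶ ((homG G).obj Y).obj S :=
  (homGSub S.unop Y).lift (prodLift v) fun _ _ e g s =>
    congrArg (fun φ : E ⟶ Y.V => ap φ e) (hv g s)

@[simp] lemma lift_eval (v : S.unop.El → (E ⟶ Y.V)) (hv) (s : S.unop.El) :
    lift v hv ≫ eval Y s = v s :=
  rfl

lemma isSheaf (Y : GSpectrum G) : Presheaf.IsSheaf (FinGSet.topology G) ((homG G).obj Y) := by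
  intro E S R hR x hx
  have hcompat ⦃T W : FinGSet G⦄ (f : T ⟶ S) (h : W ⟶ S) (hf : R f) (hh : R h) (t : T.El)
      (w : W.El) (htw : FinGSet.fn f t = FinGSet.fn h w) :
      x f hf ≫ eval (S := op T) Y t = x h hh ≫ eval (S := op W) Y w :=
    congrArg (fun φ => φ ≫ eval (S := op (FinGSet.pull f h)) Y ⟨(t, w), htw⟩)
      (hx (FinGSet.pullFst f h) (FinGSet.pullSnd f h) hf hh (FinGSet.pull_condition f h))
  obtain ⟨v, hv, hv_unique⟩ := FinGSet.existsUnique_glue hR _ hcompat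
  have hv_act (g : G) (s : S.El) : v (S.act g s) = v s ≫ Y.ρ g := by
    obtain ⟨T, f, t, hf, rfl⟩ := hR s
    rw [← FinGSet.fn_act, hv f hf, hv f hf, eval_act (S := op T), Category.assoc]
  refine ⟨lift (S := op S) v hv_act, fun T f hf => hom_ext fun t => ?_, fun y hy => hom_ext ?_⟩
  · change (lift (S := op S) v hv_act ≫ ((homG G).obj Y).map f.op) ≫ eval Y t = _
    rw [Category.assoc, map_eval, lift_eval]
    exact hv f hf t
  · refine congrFun (hv_unique (fun s => y ≫ eval (S := op S) Y s) fun T f hf t => ?_)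
    rw [← hy f hf]
    rfl

section Level

variable {A : SSet.{u}} {k : ℕ}

lemma level_hom_ext {φ ψ : A ⟶ ((((homG G).obj Y).obj S).level k).sset}
    (h : ∀ s, φ ≫ (Hom.level (eval Y s) k).hom = ψ ≫ (Hom.level (eval Y s) k).hom) : φ = ψ :=
  NatTrans.ext (funext fun m => types_ext fun a => Subtype.ext (funext fun s =>
    congrArg (fun χ : A ⟶ (Y.V.level k).sset => χ.app m a) (h s)))

/-- The simplicial map `A ⟶ Hom_G(S, Y)ₖ` given by an equivariant function from `S` to the
simplicial maps `A ⟶ Yₖ`. -/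
def levelLift (v : S.unop.El → (A ⟶ (Y.V.level k).sset))
    (hv : ∀ g s, v (S.unop.act g s) = v s ≫ (Hom.level (Y.ρ g) k).hom) :
    A ⟶ ((((homG G).obj Y).obj S).level k).sset where
  app m := ↾(fun a => ⟨fun s => (v s).app m a, fun g s =>
    congrArg (fun χ : A ⟶ (Y.V.level k).sset => χ.app m a) (hv g s)⟩)
  naturality _ _ θ := types_ext fun a => Subtype.ext (funext fun s =>
    NatTrans.naturality_apply (v s) θ a)

end Level

lemma ap_eval_mem_colimFixedSub (s : S.unop.El) {k n}
    (f : (((homG G).obj Y).obj S).Simplex k n) :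
    ap (eval Y s) f ∈ (GSpectrum.colimFixedSub Y).carrier k n := by
  refine Set.mem_iUnion.2 ⟨S.unop.actionKernel, fun g hg => ?_⟩
  rw [GSpectrum.act, ← ap_comp, ← eval_act, FinGSet.act_eq_of_mem_actionKernel hg]

instance isIso_map_colimFixedι (Y : GSpectrum G) : IsIso ((homG G).map Y.colimFixedι) := by
  have (S : (FinGSet G)ᵒᵖ) : IsIso (((homG G).map Y.colimFixedι).app S) :=
    ⟨lift (Y := Y.colimFixedG)
      (fun s => (GSpectrum.colimFixedSub Y).lift (eval Y s) fun _ _ => ap_eval_mem_colimFixedSub s)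
      fun g s => (GSpectrum.colimFixedSub Y).ι_injective (eval_act g s), rfl, rfl⟩
  exact NatIso.isIso_of_isIso_app _

section Holim

variable {C : Type u} [SmallCategory C] (X : C ⥤ GSpectrum G) (S : (FinGSet G)ᵒᵖ)

/-- Evaluation at `s`, as a map of diagrams `Hom_G(S, X) ⟶ X`. -/
def diagramEval (s : S.unop.El) :
    (X ⋙ homG G).flip.obj S ⟶ X ⋙ Action.forget Spectrum.{u} G where
  app c := eval (X.obj c) s
  naturality _ _ _ := rfl

lemma holimMap_diagramEval_act (g : G) (s : S.unop.El) :
    holimMap (diagramEval X S (S.unop.act g s)) =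
      holimMap (diagramEval X S s) ≫ (GSpectrum.holim X).ρ g := by
  have h : diagramEval X S (S.unop.act g s) = diagramEval X S s ≫ GSpectrum.diagramAct X g :=
    NatTrans.ext (funext fun c => eval_act g s)
  exact (congrArg holimMap h).trans
    ((holimFunctor C).map_comp (diagramEval X S s) (GSpectrum.diagramAct X g))

/-- The comparison map `holim_C Hom_G(S, X) ⟶ Hom_G(S, holim_C X)`. -/
def holimComparison : holimPresheaf (X ⋙ homG G) ⟶ (homG G).obj (GSpectrum.holim X) where
  app S := lift (fun s => holimMap (diagramEval X S s)) (holimMap_diagramEval_act X S)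
  naturality _ _ _ := rfl

variable {k : ℕ} {n : SimplexCategoryᵒᵖ}

lemma holimComparison_app_injective :
    Function.Injective (ap ((holimComparison X).app S) :
      ((holimPresheaf (X ⋙ homG G)).obj S).Simplex k n → _) := by
  intro x y hxy
  refine holim_simplex_ext fun c => level_hom_ext fun s => ?_
  exact congrArg (fun f => holimComponent (ap (eval (GSpectrum.holim X) s) f) c) hxy

lemma holimComparison_app_surjective :
    Function.Surjective (ap ((holimComparison X).app S) :
      ((holimPresheaf (X ⋙ homG G)).obj S).Simplex k n → _) := by
  intro f
  let F (s : S.unop.El) : (Spectrum.holim (X ⋙ Action.forget Spectrum.{u} G)).Simplex k n :=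
    ap (eval (GSpectrum.holim X) s) f
  have hF (g : G) (s : S.unop.El) : F (S.unop.act g s) = (GSpectrum.holim X).act g (F s) := f.2 g s
  exact ⟨holimSimplexMk (X := (X ⋙ homG G).flip.obj S)
    (fun c => levelLift (fun s => holimComponent (F s) c) fun g s =>
      congrArg (fun x => holimComponent x c) (hF g s))
    fun σ => level_hom_ext fun s => holimComponent_comp_map (F s) σ, rfl⟩

instance isIso_holimComparison : IsIso (holimComparison X) := by
  have (S : (FinGSet G)ᵒᵖ) : IsIso ((holimComparison X).app S) :=
    isIso_of_bijective _ fun _ _ =>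
      ⟨holimComparison_app_injective X S, holimComparison_app_surjective X S⟩
  exact NatIso.isIso_of_isIso_app _

/-- The isomorphism `holim_C Hom_G(-, X) ≅ Hom_G(-, colim_N (holim_C X)^N)`. -/
def holimIso : holimPresheaf (X ⋙ homG G) ≅ (homG G).obj (GSpectrum.holim X).colimFixedG :=
  asIso (holimComparison X) ≪≫ (asIso ((homG G).map (GSpectrum.holim X).colimFixedι)).symm

end Holim

end homG

end

theorem lemma2p6_general {G : Type u} [Group G] [TopologicalSpace G]
    {C : Type u} [SmallCategory C] (X : C ⥤ GSpectrum G) :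
    Nonempty (holimPresheaf (X ⋙ homG G) ≅ (homG G).obj (GSpectrum.holim X).colimFixedG) ∧
      Presheaf.IsSheaf (FinGSet.topology G) ((homG G).obj (GSpectrum.holim X).colimFixedG) ∧
      Presheaf.IsSheaf (FinGSet.topology G) (holimPresheaf (X ⋙ homG G)) := by
  have h := homG.isSheaf (GSpectrum.holim X).colimFixedG
  exact ⟨⟨homG.holimIso X⟩, h, (Presheaf.isSheaf_of_iso_iff (homG.holimIso X)).2 h⟩

theorem lemma2p6 (G : Type u) [Group G] [TopologicalSpace G] [IsTopologicalGroup G]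
    [CompactSpace G] [T2Space G] [TotallyDisconnectedSpace G]
    (C : Type u) [SmallCategory C] (X : C ⥤ DiscreteGSpectrum G) :
    Nonempty (holimPresheaf (X ⋙ discreteHomG G) ≅
        (discreteHomG G).obj (DiscreteGSpectrum.holim X).colimFixed) ∧
      Presheaf.IsSheaf (FinGSet.topology G)
        ((discreteHomG G).obj (DiscreteGSpectrum.holim X).colimFixed) ∧
      Presheaf.IsSheaf (FinGSet.topology G) (holimPresheaf (X ⋙ discreteHomG G)) :=
  lemma2p6_general (X ⋙ (GSpectrum.isDiscrete G).ι)
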